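/- **Theorem (High temperature zeros).** Let $\Lambda\subset\mathbb Z^D$ be a finite set of $n$ sites carrying a $d$-dimensional qudit ($d\ge 1$) on each site, and let $H=\sum_{\emptyset\ne X\subseteq\Lambda}H_X$ act on $\bigotimes_{i\in\Lambda}\mathbb C^d$, where each $H_X$ is a Hermitian operator acting non-trivially only on the sites in $X$, with operator norm $\|H_X\|\le h$. Suppose that $H$ is geometrically local with locality $\kappa\ge 1$ and range $R$, i.e. $H_X=0$ whenever $|X|>\kappa$ or $\operatorname{diam}(X)>R$, and that $g$ is a growth constant of $H$, i.e. $$\sum_{X\ni x_0}\|H_X\|\le g\,h\qquad\text{for every site }x_0\in\Lambda$$ (for instance, $g$ may be any upper bound on the number of non-zero terms acting on a site); here $g,h>0$. Let $$Z_\beta(\Lambda)=\operatorname{Tr}\,e^{-\beta H},\qquad \beta_0=\frac{1}{5e\,g\,h\,\kappa}.$$ Then $Z_\beta(\Lambda)\neq 0$ for all $\beta\in\mathbb C$ with $|\beta|\le\beta_0$. Moreover $\log Z_\beta(\Lambda)$ is analytic there, i.e. there is a function $L$, analytic on a neighbourhood of the closed disk $|\beta|\le\beta_0$, with $L(0)=n\log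 d$ and $e^{L(\beta)}=Z_\beta(\Lambda)$ on this disk; and $$\bigl|\log|Z_\beta(\Lambda)|\bigr|\le\bigl(e^2 g h|\beta|+\log d\bigr)\,n\qquad\text{for all }|\beta|\le\beta_0 .$$ -/

import Mathlib

namespace QuditLattice

/-- Classical configurations of `d`-level particles (qudits) placed on the sites of the finite
lattice `Λ ⊂ ℤ^D`. They label the product orthonormal basis of `⨂_{i ∈ Λ} ℂ^d`. -/
abbrev Config {D : ℕ} (Λ : Finset (Fin D → ℤ)) (d : ℕ) : Type := Λ → Fin d

/-- Linear operators on the Hilbert space `⨂_{i ∈ Λ} ℂ^d`, as matrices in the product basis. -/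
abbrev Operator {D : ℕ} (Λ : Finset (Fin D → ℤ)) (d : ℕ) : Type :=
  Matrix (Config Λ d) (Config Λ d) ℂ

/-- The operator norm, with respect to the Hilbert space (Euclidean) norm. -/
noncomputable def opNorm {D : ℕ} {Λ : Finset (Fin D → ℤ)} {d : ℕ} (A : Operator Λ d) : ℝ :=
  ‖Matrix.toEuclideanCLM (n := Config Λ d) (𝕜 := ℂ) A‖

/-- `A` acts non-trivially only on the sites in `X`: it has the form `B ⊗ 1`, where `B` is an
operator on `⨂_{i ∈ X} ℂ^d` and `1` is the identity of the tensor factors outside `X`. -/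
def ActsOnlyOn {D : ℕ} {Λ : Finset (Fin D → ℤ)} {d : ℕ} (A : Operator Λ d) (X : Finset Λ) :
    Prop :=
  ∃ B : Matrix (X → Fin d) (X → Fin d) ℂ, ∀ σ τ : Config Λ d,
    ((∀ i, i ∉ X → σ i = τ i) → A σ τ = B (fun i => σ i) (fun i => τ i)) ∧
    (¬ (∀ i, i ∉ X → σ i = τ i) → A σ τ = 0)

/-- A family of interaction terms `H_X`, `X ⊆ Λ`: Hermitian operators, `H_X` acting non-trivially
only on `X`. Every term acts on at least one site, so there is no term for `X = ∅` (such a term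
would be an additive constant). -/
structure Interaction {D : ℕ} (Λ : Finset (Fin D → ℤ)) (d : ℕ) where
  term : Finset Λ → Operator Λ d
  isHermitian : ∀ X, (term X).IsHermitian
  actsOnlyOn : ∀ X, ActsOnlyOn (term X) X
  term_empty : term ∅ = 0

namespace Interaction

variable {D : ℕ} {Λ : Finset (Fin D → ℤ)} {d : ℕ}

/-- The Hamiltonian `H = ∑_{X ⊆ Λ} H_X`. -/
noncomputable def hamiltonian (Φ : Interaction Λ d) : Operator Λ d :=
  ∑ X : Finset Λ, Φ.term X

/-- `(κ, R)`-local (geometrically local, with locality `κ` and range `R`): `H_X = 0` whenever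
`|X| > κ` or `diam X > R`. -/
def IsGeometricallyLocal (Φ : Interaction Λ d) (κ : ℕ) (R : ℝ) : Prop :=
  ∀ X : Finset Λ, (κ < X.card ∨ R < Metric.diam (X : Set Λ)) → Φ.term X = 0

/-- Every term has operator norm at most `h`. -/
def TermNormLE (Φ : Interaction Λ d) (h : ℝ) : Prop :=
  ∀ X : Finset Λ, opNorm (Φ.term X) ≤ h

/-- `g` is a growth constant, relative to the norm bound `h`: the total strength of the terms
that act on any given site is at most `g h`. In particular any bound `g` on the number of
non-zero terms touching a site is a growth constant. -/
def IsGrowthConstant (Φ : Interaction Λ d) (h g : ℝ) : Prop :=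
  ∀ x₀ : Λ, ∑ X : Finset Λ with x₀ ∈ X, opNorm (Φ.term X) ≤ g * h

/-- The partition function `Z_β(Λ) = Tr exp(-β H)` at complex inverse temperature `β`. -/
noncomputable def partitionFunction (Φ : Interaction Λ d) (β : ℂ) : ℂ :=
  (NormedSpace.exp ((-β) • Φ.hamiltonian)).trace

end Interaction

end QuditLattice

/-! For a family `C` of supports let `E C` be the trace of `exp (-β ∑ X ∈ C, H_X)` divided by the
dimension. It suffices to show that deleting all terms through one site costs at most a factor `q =
exp (e² g h |β|)`, that is `‖E (avoiding C {x})‖ ≤ q ‖E C‖`. Deleting every site then gives `1 ≤ q ^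
n ‖E univ‖`, hence both the absence of zeros and the lower bound on `log |Z|`; the upper bound is
the trivial norm estimate.

Two facts about `E` suffice: it is multiplicative over families with disjoint supports, and its
finite difference in directions `K` at `∅` is at most `∏ (exp (|β| ‖H_X‖) - 1)`
(`norm_finiteDiff_exp_sum_le`). The one-site bound (`norm_avoiding_singleton_le`) goes by induction
on the size of `C`. The change of `E` telescopes into differences in single directions `X ∋ x`. Each
is explored by `norm_finiteDiff_le_siteProd`: a remaining term that meets the explored region `V` is
either dropped or added to the directions, enlarging `V`, until the rest avoids `V` and the
difference factorizes. Newly absorbed sites are paid for by the induction hypothesis. The scheme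
closes if the accumulated product at each site is at most `2 - q⁻¹`, which the choice of `β₀`
guarantees. -/

/-- The iterated finite difference of a set function `f`, in the directions `K`, at `C`. -/
def finiteDiff {ι A : Type*} [DecidableEq ι] [AddCommGroup A] (f : Finset ι → A)
    (K C : Finset ι) : A :=
  ∑ J ∈ K.powerset, (-1 : ℤ) ^ (K.card + J.card) • f (J ∪ C)

/-! ### Finite differences of set functions -/

section FiniteDiff

variable {ι A : Type*} [DecidableEq ι] [AddCommGroup A]

theorem finiteDiff_empty (f : Finset ι → A) (C : Finset ι) : finiteDiff f ∅ C = f C := by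
  simp [finiteDiff]

theorem finiteDiff_insert (f : Finset ι → A) {K : Finset ι} {X : ι} (hX : X ∉ K)
    (C : Finset ι) :
    finiteDiff f (insert X K) C = finiteDiff f K (insert X C) - finiteDiff f K C := by
  unfold finiteDiff
  rw [Finset.sum_powerset_insert hX, ← Finset.sum_sub_distrib, ← Finset.sum_add_distrib]
  refine Finset.sum_congr rfl fun J hJ => ?_
  have hXJ : X ∉ J := fun h => hX (Finset.mem_powerset.1 hJ h)
  rw [Finset.card_insert_of_notMem hX, Finset.card_insert_of_notMem hXJ,
    Finset.insert_union, Finset.union_insert,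
    show K.card + 1 + J.card = K.card + J.card + 1 by ring,
    show K.card + 1 + (J.card + 1) = K.card + J.card + 2 by ring]
  simp only [pow_add, pow_one, mul_neg, mul_one, neg_smul, even_two, Even.neg_pow, one_pow]
  abel

end FiniteDiff

/-! ### Finite differences of the noncommutative exponential -/

section Exp

variable {ι : Type*} [DecidableEq ι]

/-- By inclusion–exclusion the difference of the `m`-th power at `∅` sums the words of length `m`
whose set of letters is exactly `K`. After splitting off the first letter `X`, the remaining word
may or may not use `X` again. -/
theorem finiteDiff_sum_pow_succ {𝔸 : Type*} [Ring 𝔸] (A : ι → 𝔸) (m : ℕ) (K : Finset ι) :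
    finiteDiff (fun C => (∑ X ∈ C, A X) ^ (m + 1)) K ∅ =
      ∑ X ∈ K, A X * (finiteDiff (fun C => (∑ X ∈ C, A X) ^ m) K ∅ +
        finiteDiff (fun C => (∑ X ∈ C, A X) ^ m) (K.erase X) ∅) := by
  have h1 : finiteDiff (fun C => (∑ X ∈ C, A X) ^ (m + 1)) K ∅ =
      ∑ X ∈ K, ∑ J ∈ K.powerset, (-1 : ℤ) ^ (K.card + J.card) •
        (if X ∈ J then A X * (∑ Y ∈ J, A Y) ^ m else 0) := by
    rw [Finset.sum_comm]
    refine Finset.sum_congr rfl fun J hJ => ?_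
    simp only
    rw [← Finset.smul_sum, Finset.union_empty, pow_succ', Finset.sum_mul,
      ← Finset.sum_filter, Finset.filter_mem_eq_inter,
      Finset.inter_eq_right.2 (Finset.mem_powerset.1 hJ)]
  rw [h1]
  refine Finset.sum_congr rfl fun X hX => ?_
  obtain ⟨K, hXK, rfl⟩ : ∃ L, X ∉ L ∧ K = insert X L :=
    ⟨K.erase X, by simp, (Finset.insert_erase hX).symm⟩
  rw [Finset.erase_insert hXK, finiteDiff_insert _ hXK, sub_add_cancel,
    Finset.sum_powerset_insert hXK, finiteDiff, Finset.mul_sum]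
  rw [Finset.sum_eq_zero, zero_add]
  · refine Finset.sum_congr rfl fun J hJ => ?_
    have hXJ : X ∉ J := fun h => hXK (Finset.mem_powerset.1 hJ h)
    rw [Finset.card_insert_of_notMem hXK, Finset.card_insert_of_notMem hXJ,
      show K.card + 1 + (J.card + 1) = K.card + J.card + 2 by ring]
    rw [pow_add, neg_one_sq, mul_one, mul_smul_comm]
    simp
  · intro J hJ
    have hXJ : X ∉ J := fun h => hXK (Finset.mem_powerset.1 hJ h)
    simp [hXJ]

/-- The word recursion has no signs, so norms pass through it and the scalar sum over the same words
is a majorant. The factor `‖1‖` comes from the empty word. -/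
theorem norm_finiteDiff_sum_pow_le {𝔸 : Type*} [NormedRing 𝔸] (A : ι → 𝔸) (m : ℕ)
    (K : Finset ι) :
    ‖finiteDiff (fun C => (∑ X ∈ C, A X) ^ m) K ∅‖ ≤
      finiteDiff (fun C => (∑ X ∈ C, ‖A X‖) ^ m) K ∅ * ‖(1 : 𝔸)‖ := by
  induction m generalizing K with
  | zero =>
    induction K using Finset.induction_on with
    | empty => simp [finiteDiff_empty]
    | insert X K hX _ => 
      rw [finiteDiff_insert _ hX, finiteDiff_insert _ hX]
      simp [finiteDiff]
  | succ m ih =>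
    rw [finiteDiff_sum_pow_succ, finiteDiff_sum_pow_succ, Finset.sum_mul]
    refine (norm_sum_le _ _).trans (Finset.sum_le_sum fun X _ => ?_)
    refine (norm_mul_le _ _).trans ?_
    rw [mul_assoc, add_mul]
    gcongr
    exact (norm_add_le _ _).trans (add_le_add (ih _) (ih _))

theorem finiteDiff_exp_sum (a : ι → ℝ) (K C : Finset ι) (h : Disjoint K C) :
    finiteDiff (fun C => Real.exp (∑ X ∈ C, a X)) K C =
      (∏ X ∈ K, (Real.exp (a X) - 1)) * Real.exp (∑ X ∈ C, a X) := by
  induction K using Finset.induction_on generalizing C with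
  | empty => simp [finiteDiff_empty]
  | insert X K hX ih =>
    rw [Finset.disjoint_insert_left] at h
    rw [finiteDiff_insert _ hX, ih _ (by simp [hX, h.2]), ih _ h.2, Finset.prod_insert hX,
      Finset.sum_insert h.1, Real.exp_add]
    ring

/-- The power bound is summed over the exponential series; the scalar majorant is evaluated in
closed form because real exponentials factor. -/
theorem norm_finiteDiff_exp_sum_le {𝔸 : Type*} [NormedRing 𝔸] [NormOneClass 𝔸]
    [NormedAlgebra ℂ 𝔸] [CompleteSpace 𝔸] (A : ι → 𝔸) (K : Finset ι) :
    ‖finiteDiff (fun C => NormedSpace.exp (∑ X ∈ C, A X)) K ∅‖ ≤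
      ∏ X ∈ K, (Real.exp ‖A X‖ - 1) := by
  have h1 : HasSum (fun m : ℕ => ((m.factorial : ℂ)⁻¹) •
      finiteDiff (fun C => (∑ X ∈ C, A X) ^ m) K ∅)
      (finiteDiff (fun C => NormedSpace.exp (∑ X ∈ C, A X)) K ∅) := by
    simp only [finiteDiff, Finset.smul_sum]
    refine hasSum_sum fun J _ => ?_
    simp only [smul_comm _ ((-1 : ℤ) ^ _)]
    exact (NormedSpace.exp_series_hasSum_exp' (𝕂 := ℂ) _).const_smul _
  have h2 : HasSum (fun m : ℕ => ((m.factorial : ℝ)⁻¹) •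
      finiteDiff (fun C => (∑ X ∈ C, ‖A X‖) ^ m) K ∅)
      (finiteDiff (fun C => Real.exp (∑ X ∈ C, ‖A X‖)) K ∅) := by
    simp only [finiteDiff, Finset.smul_sum]
    refine hasSum_sum fun J _ => ?_
    simp only [smul_comm _ ((-1 : ℤ) ^ _)]
    rw [Real.exp_eq_exp_ℝ]
    exact (NormedSpace.exp_series_hasSum_exp' (𝕂 := ℝ) _).const_smul _
  have h3 := finiteDiff_exp_sum (fun X => ‖A X‖) K ∅ (by simp)
  rw [Finset.sum_empty, Real.exp_zero, mul_one] at h3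
  rw [← h3, ← h1.tsum_eq]
  refine tsum_of_norm_bounded h2 fun m => ?_
  rw [norm_smul, norm_inv, RCLike.norm_natCast, smul_eq_mul]
  gcongr
  simpa using norm_finiteDiff_sum_pow_le A m K

end Exp

/-! ### Abstract exploration argument for removing sites -/

section Polymer

variable {S : Type*} [DecidableEq S]

/-- The members of the family `C` that are disjoint from `V`. -/
def avoiding (C : Finset (Finset S)) (V : Finset S) : Finset (Finset S) :=
  C.filter fun X => Disjoint X V

theorem avoiding_avoiding (C : Finset (Finset S)) (V W : Finset S) :
    avoiding (avoiding C V) W = avoiding C (V ∪ W) := by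
  simp [avoiding, Finset.filter_filter]

theorem avoiding_erase {C : Finset (Finset S)} {X V : Finset S} (h : ¬ Disjoint X V) :
    avoiding (C.erase X) V = avoiding C V := by
  ext Y
  simp only [avoiding, Finset.mem_filter, Finset.mem_erase]
  constructor
  · tauto
  · rintro ⟨h1, h2⟩
    exact ⟨⟨fun e => h (e ▸ h2), h1⟩, h2⟩

/-- The product of `1 + b X` over the members `X` of `C` that contain the site `v`. -/
def siteProd (b : Finset S → ℝ) (C : Finset (Finset S)) (v : S) : ℝ :=
  ∏ X ∈ C with v ∈ X, (1 + b X)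

theorem one_le_siteProd {b : Finset S → ℝ} (hb : ∀ X, 0 ≤ b X) (C : Finset (Finset S)) (v : S) :
    1 ≤ siteProd b C v :=
  Finset.one_le_prod fun X _ => by linarith [hb X]

theorem siteProd_mono {b : Finset S → ℝ} (hb : ∀ X, 0 ≤ b X) {C C' : Finset (Finset S)}
    (h : C ⊆ C') (v : S) : siteProd b C v ≤ siteProd b C' v :=
  Finset.prod_le_prod_of_subset_of_one_le (Finset.filter_subset_filter _ h)
    (fun X _ => by linarith [hb X]) fun X _ _ => by linarith [hb X]

theorem siteProd_erase {b : Finset S → ℝ} {C : Finset (Finset S)} {X : Finset S} (hX : X ∈ C)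
    {v : S} (hv : v ∈ X) : siteProd b C v = (1 + b X) * siteProd b (C.erase X) v := by
  unfold siteProd
  rw [← Finset.mul_prod_erase (C.filter fun X => v ∈ X) _ (a := X) (by simp [hX, hv]),
    Finset.filter_erase]

/-- If removing a site costs at most a factor `q`, removing the sites in `W` costs at most
`q ^ |W|`. -/
theorem norm_avoiding_le_pow {E : Finset (Finset S) → ℂ} {q : ℝ} (hq : 0 ≤ q)
    (W : Finset S) (C : Finset (Finset S))
    (h : ∀ C' ⊆ C, ∀ x, ‖E (avoiding C' {x})‖ ≤ q * ‖E C'‖) :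
    ‖E (avoiding C W)‖ ≤ q ^ W.card * ‖E C‖ := by
  induction W using Finset.induction_on with
  | empty => simp [avoiding]
  | insert x W hx ih =>
    have h1 := h (avoiding C W) (Finset.filter_subset _ _) x
    rw [avoiding_avoiding, Finset.union_comm, ← Finset.insert_eq] at h1
    rw [Finset.card_insert_of_notMem hx, pow_succ', mul_assoc]
    exact h1.trans (by gcongr)

/-- The weight of a finite difference which multiplies out when the base point is far from the
directions. -/
theorem norm_finiteDiff_le_of_disjoint {E : Finset (Finset S) → ℂ} {b : Finset S → ℝ}
    (hE : ∀ K C : Finset (Finset S), Disjoint K C → (∀ X ∈ K, ∀ Y ∈ C, Disjoint X Y) →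
      E (K ∪ C) = E K * E C)
    (hK : ∀ K, ‖finiteDiff E K ∅‖ ≤ ∏ X ∈ K, b X)
    (K C : Finset (Finset S)) (hKC : Disjoint K C)
    (h : ∀ X ∈ K, ∀ Y ∈ C, Disjoint X Y) :
    ‖finiteDiff E K C‖ ≤ (∏ X ∈ K, b X) * ‖E C‖ := by
  have h1 : finiteDiff E K C = finiteDiff E K ∅ * E C := by
    unfold finiteDiff
    rw [Finset.sum_mul]
    refine Finset.sum_congr rfl fun J hJ => ?_
    have hJK := Finset.mem_powerset.1 hJ
    rw [Finset.union_empty, hE J C (Finset.disjoint_of_subset_left hJK hKC)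
      fun X hX => h X (hJK hX), smul_mul_assoc]
  rw [h1, norm_mul]
  gcongr
  exact hK K

/-- The term-by-term exploration bound for finite differences, given that removing a site from a
smaller family costs at most a factor `q`. -/
theorem norm_finiteDiff_le_siteProd {E : Finset (Finset S) → ℂ} {b : Finset S → ℝ} {q M : ℝ}
    (hb : ∀ X, 0 ≤ b X) (hq : 1 ≤ q) (hM : 1 ≤ M)
    (hE : ∀ K C : Finset (Finset S), Disjoint K C → (∀ X ∈ K, ∀ Y ∈ C, Disjoint X Y) →
      E (K ∪ C) = E K * E C)
    (hK : ∀ K, ‖finiteDiff E K ∅‖ ≤ ∏ X ∈ K, b X)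
    (hp : ∀ C v, siteProd (fun X => b X * (M * q) ^ (X.card - 1)) C v ≤ M)
    (n : ℕ) (ih : ∀ C : Finset (Finset S), C.card < n →
      ∀ x, ‖E (avoiding C {x})‖ ≤ q * ‖E C‖)
    (C : Finset (Finset S)) (hC : C.card ≤ n) (K : Finset (Finset S)) (V : Finset S)
    (hKV : ∀ X ∈ K, X ⊆ V) (hKC : Disjoint K C) :
    ‖finiteDiff E K C‖ ≤ (∏ X ∈ K, b X) * ‖E (avoiding C V)‖ *
      ∏ v ∈ V, siteProd (fun X => b X * (M * q) ^ (X.card - 1)) C v := by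
  set c : Finset S → ℝ := fun X => b X * (M * q) ^ (X.card - 1) with hc
  have hc0 : ∀ X, 0 ≤ c X := fun X => mul_nonneg (hb X) (by positivity)
  have hbK : ∀ K : Finset (Finset S), 0 ≤ ∏ X ∈ K, b X :=
    fun K => Finset.prod_nonneg fun X _ => hb X
  induction hm : C.card generalizing C K V with
  | zero =>
    obtain rfl := Finset.card_eq_zero.1 hm
    simpa [avoiding, siteProd] using
      norm_finiteDiff_le_of_disjoint hE hK K ∅ (by simp) (by simp)
  | succ m ihm =>
    by_cases hex : ∃ X ∈ C, ¬ Disjoint X V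
    · obtain ⟨X, hXC, hXV⟩ := hex
      have hXK : X ∉ K := fun h => Finset.disjoint_left.1 hKC h hXC
      have hcard : (C.erase X).card = m := by rw [Finset.card_erase_of_mem hXC, hm]; rfl
      have hdisj : Disjoint K (C.erase X) :=
        Finset.disjoint_of_subset_right (Finset.erase_subset _ _) hKC
      -- The exploration step: `X` meets `V`, and is either dropped or becomes a new direction, with
      -- `V` growing to `V ∪ X`.
      have hrec : finiteDiff E K C =
          finiteDiff E K (C.erase X) + finiteDiff E (insert X K) (C.erase X) := by
        rw [finiteDiff_insert E hXK, Finset.insert_erase hXC]; ring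
      have h1 := ihm (C.erase X) (by omega) K V hKV hdisj hcard
      have h2 := ihm (C.erase X) (by omega) (insert X K) (V ∪ X)
        (by
          intro Y hY
          rcases Finset.mem_insert.1 hY with rfl | hY
          · exact Finset.subset_union_right
          · exact (hKV Y hY).trans Finset.subset_union_left)
        (by simp [hdisj]) hcard
      have hoff : avoiding (C.erase X) V = avoiding C V := avoiding_erase hXV
      have hoff2 : avoiding (C.erase X) (V ∪ X) = avoiding (avoiding C V) (X \ V) := by
        rw [avoiding_avoiding, Finset.union_sdiff_self_eq_union]
        exact avoiding_erase fun h => hXV (Finset.disjoint_union_right.1 h).1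
      have hsub : avoiding C V ⊆ C.erase X := hoff ▸ Finset.filter_subset _ _
      -- The families met here lie in `C.erase X`, so they have fewer than `n` members and `ih`
      -- applies.
      have hratio : ‖E (avoiding (avoiding C V) (X \ V))‖ ≤
          q ^ (X \ V).card * ‖E (avoiding C V)‖ := by
        refine norm_avoiding_le_pow (by linarith) _ _ fun C' hC' => ih C' ?_
        have := Finset.card_le_card (hC'.trans hsub)
        omega
      -- Since `X` meets `V`, at most `|X| - 1` sites are new; this is the exponent in the weight
      -- `c`.
      have hcardX : (X \ V).card ≤ X.card - 1 := by
        have : (X \ V).card < X.card := by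
          refine Finset.card_lt_card (Finset.ssubset_iff_subset_ne.2
            ⟨Finset.sdiff_subset, fun h => hXV ?_⟩)
          exact Finset.sdiff_eq_self_iff_disjoint.1 h
        omega
      set P := ∏ v ∈ V, siteProd c (C.erase X) v with hP
      have hP0 : 0 ≤ P :=
        Finset.prod_nonneg fun v _ => zero_le_one.trans (one_le_siteProd hc0 _ v)
      have hprod : ∏ v ∈ V ∪ X, siteProd c (C.erase X) v ≤ P * M ^ (X \ V).card := by
        rw [← Finset.union_sdiff_self_eq_union, Finset.prod_union Finset.disjoint_sdiff]
        gcongr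
        rw [← Finset.prod_const]
        exact Finset.prod_le_prod
          (fun v _ => zero_le_one.trans (one_le_siteProd hc0 _ v)) fun v _ => hp _ v
      -- The factor `1 + c X` is absorbed by the product at one site of `X ∩ V`.
      have hPC : (1 + c X) * P ≤ ∏ v ∈ V, siteProd c C v := by
        obtain ⟨v, hvX, hvV⟩ := Finset.not_disjoint_iff.1 hXV
        rw [hP, ← Finset.mul_prod_erase V _ hvV, ← Finset.mul_prod_erase V _ hvV,
          ← mul_assoc, ← siteProd_erase hXC hvX]
        refine mul_le_mul_of_nonneg_left ?_ (zero_le_one.trans (one_le_siteProd hc0 _ v))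
        exact Finset.prod_le_prod
          (fun v _ => zero_le_one.trans (one_le_siteProd hc0 _ v))
          fun v _ => siteProd_mono hc0 (Finset.erase_subset _ _) v
      have hstep : b X * (q ^ (X \ V).card * M ^ (X \ V).card) ≤ c X := by
        rw [← mul_pow, mul_comm q M]
        refine mul_le_mul_of_nonneg_left (pow_le_pow_right₀ ?_ hcardX) (hb X)
        nlinarith
      rw [hoff] at h1
      rw [hoff2, Finset.prod_insert hXK] at h2
      calc ‖finiteDiff E K C‖ ≤ ‖finiteDiff E K (C.erase X)‖ +
            ‖finiteDiff E (insert X K) (C.erase X)‖ := by rw [hrec]; exact norm_add_le _ _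
        _ ≤ (∏ X ∈ K, b X) * ‖E (avoiding C V)‖ * P + (b X * ∏ X ∈ K, b X) *
            (q ^ (X \ V).card * ‖E (avoiding C V)‖) * (P * M ^ (X \ V).card) := by
          refine add_le_add h1 (h2.trans ?_)
          have := mul_nonneg (hb X) (hbK K)
          gcongr
          exact Finset.prod_nonneg fun v _ => zero_le_one.trans (one_le_siteProd hc0 _ v)
        _ = (∏ X ∈ K, b X) * ‖E (avoiding C V)‖ *
            ((1 + b X * (q ^ (X \ V).card * M ^ (X \ V).card)) * P) := by ring
        _ ≤ (∏ X ∈ K, b X) * ‖E (avoiding C V)‖ * ∏ v ∈ V, siteProd c C v := by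
          refine mul_le_mul_of_nonneg_left ?_ (mul_nonneg (hbK K) (norm_nonneg _))
          exact le_trans (by gcongr) hPC
    · push Not at hex
      have hoff : avoiding C V = C := Finset.filter_true_of_mem hex
      have hone : 1 ≤ ∏ v ∈ V, siteProd c C v :=
        Finset.one_le_prod fun v _ => one_le_siteProd hc0 _ v
      rw [hoff]
      refine (norm_finiteDiff_le_of_disjoint hE hK K C hKC fun X hX Y hY =>
        (Finset.disjoint_of_subset_right (hKV X hX) (hex Y hY)).symm).trans ?_
      exact le_mul_of_one_le_right (mul_nonneg (hbK K) (norm_nonneg _)) hone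

/-- Removing all members of a family that contain a given site changes `E` by at most a
factor `q`. -/
theorem norm_avoiding_singleton_le {E : Finset (Finset S) → ℂ} {b : Finset S → ℝ} {q M : ℝ}
    (hb : ∀ X, 0 ≤ b X) (hq : 1 ≤ q) (hM : 1 ≤ M) (hMq : M ≤ 2 - q⁻¹)
    (hE : ∀ K C : Finset (Finset S), Disjoint K C → (∀ X ∈ K, ∀ Y ∈ C, Disjoint X Y) →
      E (K ∪ C) = E K * E C)
    (hK : ∀ K, ‖finiteDiff E K ∅‖ ≤ ∏ X ∈ K, b X)
    (hp : ∀ C v, siteProd (fun X => b X * (M * q) ^ (X.card - 1)) C v ≤ M)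
    (C : Finset (Finset S)) (x : S) : ‖E (avoiding C {x})‖ ≤ q * ‖E C‖ := by
  set c : Finset S → ℝ := fun X => b X * (M * q) ^ (X.card - 1) with hc
  have hc0 : ∀ X, 0 ≤ c X := fun X => mul_nonneg (hb X) (by positivity)
  induction hn : C.card using Nat.strong_induction_on generalizing C x with
  | _ n ih =>
    -- An inner induction peels off the terms through `x` one at a time, with the outer hypothesis
    -- held at size `n`.
    have key : ∀ m, ∀ D : Finset (Finset S), D.card = m → D.card ≤ n →
        ‖E D - E (avoiding D {x})‖ ≤ ‖E (avoiding D {x})‖ * (siteProd c D x - 1) := by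
      intro m
      induction m with
      | zero =>
        intro D hD _
        obtain rfl := Finset.card_eq_zero.1 hD
        simp [avoiding, siteProd]
      | succ m ihm =>
        intro D hD hDn
        by_cases hex : ∃ X ∈ D, x ∈ X
        · obtain ⟨X, hXD, hxX⟩ := hex
          have hcard : (D.erase X).card = m := by rw [Finset.card_erase_of_mem hXD, hD]; rfl
          have h1 := ihm (D.erase X) hcard (by omega)
          have hoff : avoiding (D.erase X) {x} = avoiding D {x} :=
            avoiding_erase (by simpa using hxX)
          have hsub : avoiding D {x} ⊆ D.erase X := hoff ▸ Finset.filter_subset _ _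
          rw [hoff] at h1
          have h2 := norm_finiteDiff_le_siteProd hb hq hM hE hK hp n
            (fun C hC y => ih C.card hC C y rfl) (D.erase X) (by omega) {X} X (by simp) (by simp)
          have hrec : finiteDiff E {X} (D.erase X) = E D - E (D.erase X) := by
            rw [← insert_empty_eq, finiteDiff_insert E (by simp), finiteDiff_empty,
              finiteDiff_empty, Finset.insert_erase hXD]
          have hoff2 : avoiding (D.erase X) X = avoiding (avoiding D {x}) (X.erase x) := by
            rw [avoiding_avoiding, ← Finset.insert_eq, Finset.insert_erase hxX]
            exact avoiding_erase fun h =>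
              Finset.disjoint_left.1 h hxX hxX
          have hratio : ‖E (avoiding (avoiding D {x}) (X.erase x))‖ ≤
              q ^ (X.card - 1) * ‖E (avoiding D {x})‖ := by
            rw [← Finset.card_erase_of_mem hxX]
            refine norm_avoiding_le_pow (by linarith) _ _ fun C' hC' y => ih C'.card ?_ C' y rfl
            have := Finset.card_le_card (hC'.trans hsub)
            omega
          have hs0 : ∀ v, 0 ≤ siteProd c (D.erase X) v :=
            fun v => zero_le_one.trans (one_le_siteProd hc0 _ v)
          have hprod : ∏ v ∈ X, siteProd c (D.erase X) v ≤
              siteProd c (D.erase X) x * M ^ (X.card - 1) := by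
            rw [← Finset.mul_prod_erase X _ hxX, ← Finset.card_erase_of_mem hxX,
              ← Finset.prod_const]
            exact mul_le_mul_of_nonneg_left
              (Finset.prod_le_prod (fun v _ => hs0 v) fun v _ => hp _ v) (hs0 x)
          rw [hrec, hoff2, Finset.prod_singleton] at h2
          calc ‖E D - E (avoiding D {x})‖
              = ‖(E D - E (D.erase X)) + (E (D.erase X) - E (avoiding D {x}))‖ := by
                congr 1; ring
            _ ≤ b X * (q ^ (X.card - 1) * ‖E (avoiding D {x})‖) *
                  (siteProd c (D.erase X) x * M ^ (X.card - 1)) +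
                ‖E (avoiding D {x})‖ * (siteProd c (D.erase X) x - 1) := by
              refine (norm_add_le _ _).trans (add_le_add (h2.trans ?_) h1)
              have := hb X
              gcongr
              exact Finset.prod_nonneg fun v _ => hs0 v
            -- With `s` the product at `x` without `X`, this is `c X * s + (s - 1) = (1 + c X) * s -
            -- 1`.
            _ = ‖E (avoiding D {x})‖ * (siteProd c D x - 1) := by
              rw [siteProd_erase hXD hxX, hc]
              simp only [mul_pow]
              ring
        · push Not at hex
          have hoff : avoiding D {x} = D :=
            Finset.filter_true_of_mem fun X hX => by simpa using hex X hX
          rw [hoff, sub_self, norm_zero]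
          exact mul_nonneg (norm_nonneg _) (by linarith [one_le_siteProd hc0 D x])
    have h1 := key _ C rfl hn.le
    have h2 : ‖E (avoiding C {x})‖ ≤ ‖E C‖ + ‖E C - E (avoiding C {x})‖ := by
      rw [norm_sub_rev]; exact norm_le_norm_add_norm_sub' _ _
    -- Here `M ≤ 2 - q⁻¹` is what makes the induction close.
    have h3 : ‖E (avoiding C {x})‖ * (siteProd c C x - 1) ≤ ‖E (avoiding C {x})‖ * (1 - q⁻¹) :=
      mul_le_mul_of_nonneg_left (by linarith [hp C x]) (norm_nonneg _)
    have h4 : ‖E (avoiding C {x})‖ * q⁻¹ ≤ ‖E C‖ := by linarith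
    rwa [← div_eq_mul_inv, div_le_iff₀' (by linarith)] at h4

end Polymer

/-! ### Traces and exponentials on tensor products -/

open scoped Kronecker

section Kronecker

open scoped Matrix.Norms.L2Operator

variable {α β γ : Type*} [Fintype α] [DecidableEq α] [Fintype β] [DecidableEq β]
  [Fintype γ] [DecidableEq γ]

/-- The embedding `a ↦ a ⊗ 1`, for a factorization `e` of the index type. -/
noncomputable def leftFactor (e : γ ≃ α × β) : Matrix α α ℂ →ₐ[ℂ] Matrix γ γ ℂ :=
  (Matrix.reindexAlgEquiv ℂ ℂ e.symm).toAlgHom.comp <| AlgHom.ofLinearMap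
    { toFun := fun a => a ⊗ₖ (1 : Matrix β β ℂ)
      map_add' := fun a b => Matrix.add_kronecker a b 1
      map_smul' := fun c a => Matrix.smul_kronecker c a 1 }
    Matrix.one_kronecker_one
    fun a b => by
      change (a * b) ⊗ₖ (1 : Matrix β β ℂ) = (a ⊗ₖ 1) * (b ⊗ₖ 1)
      rw [← Matrix.mul_kronecker_mul, mul_one]

/-- The embedding `b ↦ 1 ⊗ b`, for a factorization `e` of the index type. -/
noncomputable def rightFactor (e : γ ≃ α × β) : Matrix β β ℂ →ₐ[ℂ] Matrix γ γ ℂ :=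
  leftFactor (e.trans (Equiv.prodComm α β))

theorem leftFactor_apply (e : γ ≃ α × β) (a : Matrix α α ℂ) (σ τ : γ) :
    leftFactor e a σ τ = a (e σ).1 (e τ).1 * (1 : Matrix β β ℂ) (e σ).2 (e τ).2 := rfl

theorem rightFactor_apply (e : γ ≃ α × β) (b : Matrix β β ℂ) (σ τ : γ) :
    rightFactor e b σ τ = (1 : Matrix α α ℂ) (e σ).1 (e τ).1 * b (e σ).2 (e τ).2 :=
  mul_comm _ _

theorem leftFactor_mul_rightFactor (e : γ ≃ α × β) (a : Matrix α α ℂ) (b : Matrix β β ℂ) :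
    leftFactor e a * rightFactor e b = Matrix.reindexAlgEquiv ℂ ℂ e.symm (a ⊗ₖ b) := by
  have h1 : leftFactor e a = Matrix.reindexAlgEquiv ℂ ℂ e.symm (a ⊗ₖ 1) := rfl
  have h2 : rightFactor e b = Matrix.reindexAlgEquiv ℂ ℂ e.symm (1 ⊗ₖ b) := by
    ext σ τ; exact rightFactor_apply e b σ τ
  rw [h1, h2, ← map_mul, ← Matrix.mul_kronecker_mul, one_mul, mul_one]

theorem rightFactor_mul_leftFactor (e : γ ≃ α × β) (a : Matrix α α ℂ) (b : Matrix β β ℂ) :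
    rightFactor e b * leftFactor e a = Matrix.reindexAlgEquiv ℂ ℂ e.symm (a ⊗ₖ b) := by
  have h1 : leftFactor e a = Matrix.reindexAlgEquiv ℂ ℂ e.symm (a ⊗ₖ 1) := rfl
  have h2 : rightFactor e b = Matrix.reindexAlgEquiv ℂ ℂ e.symm (1 ⊗ₖ b) := by
    ext σ τ; exact rightFactor_apply e b σ τ
  rw [h1, h2, ← map_mul, ← Matrix.mul_kronecker_mul, one_mul, mul_one]

theorem trace_leftFactor_mul_rightFactor (e : γ ≃ α × β) (a : Matrix α α ℂ) (b : Matrix β β ℂ) :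
    (leftFactor e a * rightFactor e b).trace = a.trace * b.trace := by
  rw [leftFactor_mul_rightFactor, ← Matrix.trace_kronecker]
  simp only [Matrix.trace, Matrix.diag]
  exact Fintype.sum_equiv e _ _ fun σ => by simp

theorem exp_leftFactor (e : γ ≃ α × β) (a : Matrix α α ℂ) :
    NormedSpace.exp (leftFactor e a) = leftFactor e (NormedSpace.exp a) := by
  let : NormedAlgebra ℚ (Matrix α α ℂ) := NormedAlgebra.restrictScalars ℚ ℂ _
  exact (NormedSpace.map_exp (leftFactor e)
    (leftFactor e).toLinearMap.continuous_of_finiteDimensional a).symm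

/-- The two factors commute, so the exponential splits. Each trace on the right carries the
dimension of the opposite factor, and these multiply to `Fintype.card γ`. -/
theorem trace_exp_add_of_factors (e : γ ≃ α × β) {A B : Matrix γ γ ℂ}
    (hA : A ∈ (leftFactor e).range) (hB : B ∈ (rightFactor e).range) :
    (NormedSpace.exp (A + B)).trace * Fintype.card γ =
      (NormedSpace.exp A).trace * (NormedSpace.exp B).trace := by
  obtain ⟨a, rfl⟩ := hA
  obtain ⟨b, rfl⟩ := hB
  change (NormedSpace.exp (leftFactor e a + rightFactor e b)).trace * _ =
    (NormedSpace.exp (leftFactor e a)).trace * (NormedSpace.exp (rightFactor e b)).trace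
  have hr : NormedSpace.exp (rightFactor e b) = rightFactor e (NormedSpace.exp b) :=
    exp_leftFactor _ b
  rw [Matrix.exp_add_of_commute _ _ ((leftFactor_mul_rightFactor e a b).trans
    (rightFactor_mul_leftFactor e a b).symm), exp_leftFactor, hr,
    trace_leftFactor_mul_rightFactor]
  have h1 := trace_leftFactor_mul_rightFactor e (NormedSpace.exp a) 1
  have h2 := trace_leftFactor_mul_rightFactor e 1 (NormedSpace.exp b)
  rw [map_one, mul_one, Matrix.trace_one] at h1
  rw [map_one, one_mul, Matrix.trace_one] at h2
  rw [h1, h2, Fintype.card_congr e, Fintype.card_prod]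
  push_cast
  ring

theorem norm_trace_le (A : Matrix γ γ ℂ) : ‖A.trace‖ ≤ Fintype.card γ * ‖A‖ := by
  have h : ∀ i, ‖A i i‖ ≤ ‖A‖ := by
    intro i
    have h1 := A.l2_opNorm_mulVec (EuclideanSpace.single i (1 : ℂ))
    have h2 := PiLp.norm_apply_le ((EuclideanSpace.equiv γ ℂ).symm
      (A.mulVec (EuclideanSpace.single i (1 : ℂ)))) i
    simpa using h2.trans h1
  rw [Matrix.trace, ← nsmul_eq_mul, ← Finset.card_univ]
  exact norm_sum_le_of_le _ (fun i _ => h i) |>.trans (by simp)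

end Kronecker

/-! ### Local operators as tensor factors -/

namespace QuditLattice

variable {D : ℕ} {Λ : Finset (Fin D → ℤ)} {d : ℕ}

/-- The factorization of configurations into those on `V` and those off `V`. -/
abbrev configSplit (d : ℕ) (V : Finset Λ) :
    Config Λ d ≃ ({i // i ∈ V} → Fin d) × ({i // i ∉ V} → Fin d) :=
  Equiv.piEquivPiSubtypeProd (fun i => i ∈ V) fun _ => Fin d

/-- A predicate `p` rather than a finite set lets one statement serve both `V` and its complement,
in the subtype form used by `configSplit`. -/
theorem ActsOnlyOn.exists_local {A : Operator Λ d} {X : Finset Λ} (hA : ActsOnlyOn A X)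
    (p : Λ → Prop) (hp : ∀ i ∈ X, p i) :
    ∃ a : Matrix ({i // p i} → Fin d) ({i // p i} → Fin d) ℂ, ∀ σ τ : Config Λ d,
      ((∀ i, ¬ p i → σ i = τ i) → A σ τ = a (fun i => σ i) (fun i => τ i)) ∧
      (¬ (∀ i, ¬ p i → σ i = τ i) → A σ τ = 0) := by
  classical
  obtain ⟨B, hB⟩ := hA
  refine ⟨fun σ τ => if ∀ i : {i // p i}, i.1 ∉ X → σ i = τ i then
    B (fun i => σ ⟨i, hp i i.2⟩) (fun i => τ ⟨i, hp i i.2⟩) else 0, fun σ τ => ⟨fun h => ?_,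
    fun h => (hB σ τ).2 fun h' => h fun i hi => h' i fun hX => hi (hp i hX)⟩⟩
  beta_reduce
  split_ifs with h1
  · refine (hB σ τ).1 fun i hi => ?_
    by_cases hpi : p i
    · exact h1 ⟨i, hpi⟩ hi
    · exact h i hpi
  · exact (hB σ τ).2 fun h' => h1 fun i hi => h' i hi

theorem ActsOnlyOn.mem_range_leftFactor {A : Operator Λ d} {X V : Finset Λ}
    (hA : ActsOnlyOn A X) (h : X ⊆ V) : A ∈ (leftFactor (configSplit d V)).range := by
  obtain ⟨a, ha⟩ := hA.exists_local (· ∈ V) fun i hi => h hi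
  refine ⟨a, ?_⟩
  ext σ τ
  refine (leftFactor_apply _ a σ τ).trans ?_
  by_cases hστ : ∀ i, i ∉ V → σ i = τ i
  · have h2 : (configSplit d V σ).2 = (configSplit d V τ).2 := funext fun i => hστ i.1 i.2
    rw [(ha σ τ).1 hστ, h2, Matrix.one_apply_eq, mul_one]
    rfl
  · rw [(ha σ τ).2 hστ, Matrix.one_apply, if_neg, mul_zero]
    exact fun h' => hστ fun i hi => congrFun h' ⟨i, hi⟩

theorem ActsOnlyOn.mem_range_rightFactor {A : Operator Λ d} {X V : Finset Λ}
    (hA : ActsOnlyOn A X) (h : Disjoint X V) :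
    A ∈ (rightFactor (configSplit d V)).range := by
  obtain ⟨a, ha⟩ := hA.exists_local (· ∉ V) fun i hi => Finset.disjoint_left.1 h hi
  refine ⟨a, ?_⟩
  ext σ τ
  refine (rightFactor_apply _ a σ τ).trans ?_
  by_cases hστ : ∀ i, ¬ i ∉ V → σ i = τ i
  · have h1 : (configSplit d V σ).1 = (configSplit d V τ).1 :=
      funext fun i => hστ i.1 (not_not.2 i.2)
    rw [(ha σ τ).1 hστ, h1, Matrix.one_apply_eq, one_mul]
    rfl
  · rw [(ha σ τ).2 hστ, Matrix.one_apply, if_neg, zero_mul]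
    exact fun h' => hστ fun i hi => congrFun h' ⟨i, not_not.1 hi⟩

end QuditLattice

/-! ### Holomorphic logarithms -/

section Log

/-- A nowhere vanishing entire function has a holomorphic logarithm on a disk. -/
theorem exists_log_on_ball {f : ℂ → ℂ} {r : ℝ} (hr : 0 < r) (hf : Differentiable ℂ f)
    (h0 : ∀ z ∈ Metric.ball (0 : ℂ) r, f z ≠ 0) {c : ℂ} (hc : Complex.exp c = f 0) :
    ∃ L : ℂ → ℂ, DifferentiableOn ℂ L (Metric.ball 0 r) ∧ L 0 = c ∧
      ∀ z ∈ Metric.ball (0 : ℂ) r, Complex.exp (L z) = f z := by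
  have hd : DifferentiableOn ℂ (fun z => deriv f z / f z) (Metric.ball 0 r) :=
    hf.deriv.differentiableOn.div hf.differentiableOn h0
  obtain ⟨L, hL0, hL⟩ := hd.isExactOn_ball.with_val_at 0 c
  refine ⟨L, fun z hz => (hL z hz).differentiableAt.differentiableWithinAt, hL0, fun z hz => ?_⟩
  -- `L` is a primitive of `f' / f`, so `f * exp (-L)` is constant.
  have hder : ∀ w ∈ Metric.ball (0 : ℂ) r,
      HasDerivAt (fun w => f w * Complex.exp (-L w)) 0 w := by
    intro w hw
    refine ((hf w).hasDerivAt.mul (hL w hw).neg.cexp).congr_deriv ?_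
    simp only [Pi.neg_apply]
    have := h0 w hw
    field_simp
    ring
  have hconst := Metric.isOpen_ball.is_const_of_deriv_eq_zero
    (convex_ball (0 : ℂ) r).isPreconnected
    (fun w hw => (hder w hw).differentiableAt.differentiableWithinAt)
    (fun w hw => (hder w hw).deriv) hz (Metric.mem_ball_self hr)
  simp only [hL0, ← hc, ← Complex.exp_add, add_neg_cancel, Complex.exp_zero] at hconst
  rw [Complex.exp_neg] at hconst
  exact (eq_of_div_eq_one hconst).symm

/-- By compactness `f` has no zeros on a slightly larger open disk, so the logarithm is analytic up
to the boundary. -/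
theorem exists_log_on_closedBall {f : ℂ → ℂ} {r : ℝ} (hr : 0 ≤ r) (hf : Differentiable ℂ f)
    (h0 : ∀ z ∈ Metric.closedBall (0 : ℂ) r, f z ≠ 0) {c : ℂ} (hc : Complex.exp c = f 0) :
    ∃ L : ℂ → ℂ, AnalyticOnNhd ℂ L (Metric.closedBall 0 r) ∧ L 0 = c ∧
      ∀ z ∈ Metric.closedBall (0 : ℂ) r, Complex.exp (L z) = f z := by
  obtain ⟨δ, hδ, hsub⟩ := (isCompact_closedBall (0 : ℂ) r).exists_thickening_subset_open
    (isOpen_ne.preimage hf.continuous : IsOpen (f ⁻¹' {z | z ≠ 0})) h0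
  rw [thickening_closedBall hδ hr] at hsub
  obtain ⟨L, hL, hL0, hexp⟩ := exists_log_on_ball (by positivity) hf hsub hc
  have hball : Metric.closedBall (0 : ℂ) r ⊆ Metric.ball 0 (δ + r) :=
    Metric.closedBall_subset_ball (by linarith)
  exact ⟨L, fun z hz => hL.analyticAt (Metric.isOpen_ball.mem_nhds (hball hz)), hL0,
    fun z hz => hexp z (hball hz)⟩

end Log

/-! ### Numerical inequalities behind the constant `5e` -/

section Estimates

open Real

/-- With `y = exp (-a / 2)` the claim is `(1 - y) * (y ^ 2 + y - 1) ≥ 0`, and `y ≥ 7 / 10` makes the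
second factor positive. -/
theorem exp_half_le {a : ℝ} (h0 : 0 ≤ a) (h1 : a ≤ 3 / 5) : exp (a / 2) ≤ 2 - exp (-a) := by
  have hy : 1 - a / 2 ≤ exp (-(a / 2)) := by linarith [add_one_le_exp (-(a / 2))]
  have hy1 : exp (-(a / 2)) ≤ 1 := exp_le_one_iff.2 (by linarith)
  have h2 : exp (-a) = exp (-(a / 2)) ^ 2 := by rw [← exp_nat_mul]; congr 1; push_cast; ring
  have h3 : exp (a / 2) = (exp (-(a / 2)))⁻¹ := by rw [exp_neg, inv_inv]
  rw [h2, h3]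
  set y := exp (-(a / 2))
  have hy0 : 0 < y := exp_pos _
  rw [inv_le_iff_one_le_mul₀ hy0]
  nlinarith [mul_nonneg (sub_nonneg.2 hy1) (by nlinarith : 0 ≤ y ^ 2 + y - 1)]

theorem exp_one_sq_mul_le {u k : ℝ} (hu : 0 ≤ u) (hk : 1 ≤ k) (h : 5 * exp 1 * (u * k) ≤ 1) :
    exp 1 ^ 2 * u ≤ 3 / 5 := by
  have h1 := exp_one_lt_d9
  have h2 := exp_pos 1
  have h3 : u ≤ u * k := le_mul_of_one_le_right hu hk
  nlinarith

theorem mul_exp_le_half {u k : ℝ} (hu : 0 ≤ u) (hk : 1 ≤ k) (h : 5 * exp 1 * (u * k) ≤ 1) :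
    u * exp (u + 2 * (exp 1 ^ 2 * u) * k) ≤ exp 1 ^ 2 * u / 2 := by
  have h1 := exp_one_lt_d9
  have h2 := exp_one_gt_d9
  have h3 : u ≤ u * k := le_mul_of_one_le_right hu hk
  have h4 : u * k ≤ 3 / 40 := by nlinarith
  have h5 : exp 1 * (exp 1 * (u * k)) ≤ exp 1 * (1 / 5) := by gcongr; linarith
  -- The exponent is at most `3 / 40 + 2e / 5 < 2 - log 2`.
  have h6 : exp (u + 2 * (exp 1 ^ 2 * u) * k) ≤ exp (2 - log 2) := by
    apply exp_le_exp.2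
    have := log_two_lt_d9
    nlinarith
  have h7 : exp 2 = exp 1 * exp 1 := by rw [← exp_add]; norm_num
  rw [exp_sub, exp_log two_pos, h7] at h6
  calc _ ≤ u * (exp 1 * exp 1 / 2) := by gcongr
    _ = _ := by ring

end Estimates

/-! ### The normalized partition function -/

namespace QuditLattice.Interaction

open scoped Matrix.Norms.L2Operator

variable {D : ℕ} {Λ : Finset (Fin D → ℤ)} {d : ℕ}

theorem opNorm_eq_norm (A : Operator Λ d) : opNorm A = ‖A‖ := rfl

/-- The normalized partition function of the terms in the family `C`. -/
noncomputable def normalizedTrace (Φ : Interaction Λ d) (β : ℂ) (C : Finset (Finset Λ)) : ℂ :=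
  (NormedSpace.exp (∑ X ∈ C, (-β) • Φ.term X)).trace / Fintype.card (Config Λ d)

theorem card_config_ne_zero (hd : 1 ≤ d) : (Fintype.card (Config Λ d) : ℂ) ≠ 0 := by
  have : NeZero d := ⟨by omega⟩
  exact Nat.cast_ne_zero.2 Fintype.card_ne_zero

theorem partitionFunction_eq (Φ : Interaction Λ d) (hd : 1 ≤ d) (β : ℂ) :
    Φ.partitionFunction β = Fintype.card (Config Λ d) * Φ.normalizedTrace β Finset.univ := by
  rw [normalizedTrace, mul_div_cancel₀ _ (card_config_ne_zero hd), partitionFunction,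
    hamiltonian, Finset.smul_sum]

theorem normalizedTrace_empty (Φ : Interaction Λ d) (hd : 1 ≤ d) (β : ℂ) :
    Φ.normalizedTrace β ∅ = 1 := by
  rw [normalizedTrace, Finset.sum_empty, NormedSpace.exp_zero, Matrix.trace_one,
    div_self (card_config_ne_zero hd)]

/-- The empty support is disjoint from everything and survives the deletion, but its term is zero.
-/
theorem normalizedTrace_avoiding_univ (Φ : Interaction Λ d) (hd : 1 ≤ d) (β : ℂ) :
    Φ.normalizedTrace β (avoiding Finset.univ Finset.univ) = 1 := by
  rw [← Φ.normalizedTrace_empty hd β, normalizedTrace, normalizedTrace, Finset.sum_empty,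
    Finset.sum_eq_zero]
  intro X hX
  have : X = ∅ := disjoint_top.1 (Finset.mem_filter.1 hX).2
  rw [this, Φ.term_empty, smul_zero]

/-- The space is split along the union of the supports in `K`. Disjointness of `K` and `C` as
families is needed separately, since `∅` could belong to both. -/
theorem normalizedTrace_union (Φ : Interaction Λ d) (hd : 1 ≤ d) (β : ℂ)
    (K C : Finset (Finset Λ)) (hKC : Disjoint K C) (h : ∀ X ∈ K, ∀ Y ∈ C, Disjoint X Y) :
    Φ.normalizedTrace β (K ∪ C) = Φ.normalizedTrace β K * Φ.normalizedTrace β C := by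
  have key := trace_exp_add_of_factors (configSplit d (K.biUnion id))
    (A := ∑ X ∈ K, (-β) • Φ.term X) (B := ∑ X ∈ C, (-β) • Φ.term X)
    (sum_mem fun X hX => Subalgebra.smul_mem _
      ((Φ.actsOnlyOn X).mem_range_leftFactor (Finset.subset_biUnion_of_mem id hX)) _)
    (sum_mem fun Y hY => Subalgebra.smul_mem _
      ((Φ.actsOnlyOn Y).mem_range_rightFactor
        ((Finset.disjoint_biUnion_right _ _ _).2 fun X hX => (h X hX Y hY).symm)) _)
  have h0 := card_config_ne_zero (Λ := Λ) hd
  rw [normalizedTrace, normalizedTrace, normalizedTrace, Finset.sum_union hKC,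
    div_mul_div_comm, ← key]
  field_simp

theorem norm_trace_div_card_le (A : Operator Λ d) :
    ‖A.trace / Fintype.card (Config Λ d)‖ ≤ ‖A‖ := by
  rw [norm_div, RCLike.norm_natCast]
  exact div_le_of_le_mul₀ (Nat.cast_nonneg _) (norm_nonneg _)
    ((norm_trace_le A).trans_eq (mul_comm _ _))

theorem norm_finiteDiff_normalizedTrace_le (Φ : Interaction Λ d) (hd : 1 ≤ d) (β : ℂ)
    (K : Finset (Finset Λ)) :
    ‖finiteDiff (Φ.normalizedTrace β) K ∅‖ ≤
      ∏ X ∈ K, (Real.exp (‖β‖ * opNorm (Φ.term X)) - 1) := by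
  have : NeZero d := ⟨by omega⟩
  have h1 : finiteDiff (Φ.normalizedTrace β) K ∅ =
      (finiteDiff (fun C => NormedSpace.exp (∑ X ∈ C, (-β) • Φ.term X)) K ∅).trace /
        Fintype.card (Config Λ d) := by
    simp only [finiteDiff, normalizedTrace, Matrix.trace_sum, Matrix.trace_smul, Finset.sum_div,
      smul_div_assoc, Finset.union_empty]
  rw [h1]
  refine (norm_trace_div_card_le _).trans ((norm_finiteDiff_exp_sum_le _ K).trans_eq ?_)
  simp only [norm_smul, norm_neg, opNorm_eq_norm]

theorem norm_normalizedTrace_le (Φ : Interaction Λ d) (hd : 1 ≤ d) (β : ℂ) :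
    ‖Φ.normalizedTrace β Finset.univ‖ ≤ Real.exp (‖β‖ * ∑ X, opNorm (Φ.term X)) := by
  have : NeZero d := ⟨by omega⟩
  refine (norm_trace_div_card_le _).trans ?_
  -- A one-element family gives `‖exp A - 1‖ ≤ exp ‖A‖ - 1`.
  have h1 := norm_finiteDiff_exp_sum_le (fun _ : Unit => ∑ X, (-β) • Φ.term X) {()}
  rw [← insert_empty_eq, finiteDiff_insert _ (by simp), finiteDiff_empty, finiteDiff_empty] at h1
  simp only [insert_empty_eq, Finset.sum_singleton, Finset.sum_empty, NormedSpace.exp_zero,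
    Finset.prod_singleton] at h1
  refine (norm_le_norm_add_norm_sub' _ 1).trans ?_
  rw [norm_one]
  have h2 : Real.exp ‖∑ X, (-β) • Φ.term X‖ ≤ Real.exp (‖β‖ * ∑ X, opNorm (Φ.term X)) := by
    refine Real.exp_le_exp.2 ((norm_sum_le _ _).trans_eq ?_)
    simp only [norm_smul, norm_neg, opNorm_eq_norm, Finset.mul_sum]
  linarith

theorem sum_opNorm_le {Φ : Interaction Λ d} {h g : ℝ} (hgrowth : Φ.IsGrowthConstant h g) :
    ∑ X, opNorm (Φ.term X) ≤ g * h * Λ.card := by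
  have h0 : ∀ X, 0 ≤ opNorm (Φ.term X) := fun X => norm_nonneg _
  calc ∑ X, opNorm (Φ.term X) ≤ ∑ X : Finset Λ, ∑ x : Λ,
        if x ∈ X then opNorm (Φ.term X) else 0 := by
        refine Finset.sum_le_sum fun X _ => ?_
        rcases X.eq_empty_or_nonempty with rfl | ⟨x, hx⟩
        · simp [Φ.term_empty, opNorm_eq_norm]
        · refine le_trans ?_ (Finset.single_le_sum
            (f := fun x : Λ => if x ∈ X then opNorm (Φ.term X) else 0)
            (fun y _ => ?_) (Finset.mem_univ x))
          · simp [hx]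
          · split_ifs <;> simp [h0]
    _ = ∑ x : Λ, ∑ X : Finset Λ with x ∈ X, opNorm (Φ.term X) := by
        rw [Finset.sum_comm]
        exact Finset.sum_congr rfl fun x _ => (Finset.sum_filter _ _).symm
    _ ≤ ∑ _x : Λ, g * h := Finset.sum_le_sum fun x _ => hgrowth x
    _ = g * h * Λ.card := by simp [mul_comm]

/-- Locality caps the power of `M * q ≤ q ^ 2` at `κ`, making each weight at most a constant times
`|β| ‖H_X‖`; the growth bound then controls the sum over `X ∋ v`. -/
theorem siteProd_le {Φ : Interaction Λ d} {κ : ℕ} {R h g : ℝ} (hκ : 1 ≤ κ)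
    (hlocal : Φ.IsGeometricallyLocal κ R) (hgrowth : Φ.IsGrowthConstant h g) {β : ℂ}
    (hgh : 0 ≤ g * h)
    (hβ : 5 * Real.exp 1 * (g * h * ‖β‖ * κ) ≤ 1) {M q : ℝ}
    (hq : q = Real.exp (Real.exp 1 ^ 2 * (g * h * ‖β‖))) (hM0 : 0 ≤ M) (hMq : M ≤ q)
    (C : Finset (Finset Λ)) (v : Λ) :
    siteProd (fun X => (Real.exp (‖β‖ * opNorm (Φ.term X)) - 1) * (M * q) ^ (X.card - 1)) C v ≤
      Real.exp (Real.exp 1 ^ 2 * (g * h * ‖β‖) / 2) := by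
  set u := g * h * ‖β‖ with hu
  set a := Real.exp 1 ^ 2 * u with ha
  have hu0 : 0 ≤ u := by positivity
  have ha0 : 0 ≤ a := by positivity
  have hN : ∀ X, 0 ≤ opNorm (Φ.term X) := fun X => norm_nonneg _
  have hb0 : ∀ X, 0 ≤ Real.exp (‖β‖ * opNorm (Φ.term X)) - 1 := fun X => by
    rw [sub_nonneg]; exact Real.one_le_exp (mul_nonneg (norm_nonneg _) (hN X))
  have hq1 : 1 ≤ q := hq ▸ Real.one_le_exp ha0
  have hbound : ∀ X, v ∈ X →
      (Real.exp (‖β‖ * opNorm (Φ.term X)) - 1) * (M * q) ^ (X.card - 1) ≤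
        ‖β‖ * opNorm (Φ.term X) * Real.exp (u + 2 * a * κ) := by
    intro X hvX
    by_cases hX : κ < X.card
    · simp [hlocal X (Or.inl hX), opNorm_eq_norm]
    · set t := ‖β‖ * opNorm (Φ.term X) with ht
      have ht0 : 0 ≤ t := mul_nonneg (norm_nonneg _) (hN X)
      have htu : t ≤ u := by
        rw [hu, mul_comm, ht]
        refine mul_le_mul_of_nonneg_left (le_trans ?_ (hgrowth v)) (norm_nonneg _)
        exact Finset.single_le_sum (f := fun X => opNorm (Φ.term X)) (fun Y _ => hN Y)
          (by simpa using hvX)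
      have h1 : Real.exp t - 1 ≤ t * Real.exp u := by
        have h2 := Real.add_one_le_exp (-t)
        have h3 : Real.exp t * Real.exp (-t) = 1 := by rw [← Real.exp_add]; simp
        have h4 : Real.exp t ≤ Real.exp u := Real.exp_le_exp.2 htu
        nlinarith [Real.exp_pos t]
      have h2 : (M * q) ^ (X.card - 1) ≤ Real.exp (2 * a * κ) := by
        calc (M * q) ^ (X.card - 1) ≤ (q * q) ^ (X.card - 1) := by gcongr
          _ ≤ (q * q) ^ κ := pow_le_pow_right₀ (by nlinarith) (by omega)
          _ = Real.exp (2 * a * κ) := by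
            rw [hq, ← Real.exp_add, ← Real.exp_nat_mul]; congr 1; ring
      rw [Real.exp_add, ← mul_assoc]
      exact mul_le_mul h1 h2 (by positivity) (by positivity)
  calc _ ≤ ∏ X ∈ C with v ∈ X, Real.exp (‖β‖ * opNorm (Φ.term X) * Real.exp (u + 2 * a * κ)) := by
        refine Finset.prod_le_prod (fun X _ => ?_) fun X hX => ?_
        · exact add_nonneg zero_le_one (mul_nonneg (hb0 X) (by positivity))
        · have := hbound X (Finset.mem_filter.1 hX).2
          exact le_trans (by linarith) (Real.add_one_le_exp _)
    _ ≤ Real.exp (u * Real.exp (u + 2 * a * κ)) := by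
        rw [← Real.exp_sum, ← Finset.sum_mul, ← Finset.mul_sum]
        refine Real.exp_le_exp.2 (mul_le_mul_of_nonneg_right ?_ (Real.exp_pos _).le)
        rw [hu, mul_comm (g * h)]
        refine mul_le_mul_of_nonneg_left (le_trans ?_ (hgrowth v)) (norm_nonneg _)
        exact Finset.sum_le_sum_of_subset_of_nonneg
          (Finset.filter_subset_filter _ (Finset.subset_univ C)) fun X _ _ => hN X
    _ ≤ _ := Real.exp_le_exp.2 (mul_exp_le_half hu0 (by exact_mod_cast hκ) hβ)

theorem one_le_norm_normalizedTrace {Φ : Interaction Λ d} {κ : ℕ} {R h g : ℝ} (hd : 1 ≤ d)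
    (hκ : 1 ≤ κ) (hlocal : Φ.IsGeometricallyLocal κ R) (hgrowth : Φ.IsGrowthConstant h g)
    {β : ℂ} (hgh : 0 ≤ g * h) (hβ : 5 * Real.exp 1 * (g * h * ‖β‖ * κ) ≤ 1) :
    1 ≤ Real.exp (Real.exp 1 ^ 2 * (g * h * ‖β‖)) ^ Λ.card *
      ‖Φ.normalizedTrace β Finset.univ‖ := by
  have hu0 : 0 ≤ g * h * ‖β‖ := by positivity
  set a := Real.exp 1 ^ 2 * (g * h * ‖β‖) with ha
  have ha0 : 0 ≤ a := by positivity
  have ha1 : a ≤ 3 / 5 := exp_one_sq_mul_le hu0 (by exact_mod_cast hκ) hβ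
  have hq1 : 1 ≤ Real.exp a := Real.one_le_exp ha0
  have hinv : Real.exp a * Real.exp (-a) = 1 := by rw [← Real.exp_add]; simp
  have hM1 : 1 ≤ 2 - Real.exp (-a) := by
    linarith [Real.exp_le_one_iff.2 (by linarith : -a ≤ 0)]
  -- This is `exp a + exp (-a) ≥ 2`.
  have hMq : 2 - Real.exp (-a) ≤ Real.exp a := by
    nlinarith [sq_nonneg (Real.exp a - 1), Real.exp_pos (-a)]
  have h := norm_avoiding_le_pow (E := Φ.normalizedTrace β) (Real.exp_pos a).le
    Finset.univ Finset.univ fun C _ x =>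
      norm_avoiding_singleton_le
        (b := fun X => Real.exp (‖β‖ * opNorm (Φ.term X)) - 1)
        (M := 2 - Real.exp (-a))
        (fun X => by
          rw [sub_nonneg]
          exact Real.one_le_exp (mul_nonneg (norm_nonneg _) (norm_nonneg _)))
        hq1 hM1 (by rw [Real.exp_neg]) (Φ.normalizedTrace_union hd β)
        (Φ.norm_finiteDiff_normalizedTrace_le hd β)
        (fun C v => (siteProd_le hκ hlocal hgrowth hgh hβ rfl (by linarith) hMq C v).trans
          (exp_half_le ha0 ha1))
        C x
  rwa [normalizedTrace_avoiding_univ Φ hd, norm_one, Finset.card_univ, Fintype.card_coe] at h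

theorem differentiable_partitionFunction (Φ : Interaction Λ d) :
    Differentiable ℂ Φ.partitionFunction := by
  have h1 : Differentiable ℂ fun β : ℂ => NormedSpace.exp ((-β) • Φ.hamiltonian) := fun β =>
    (HasDerivAt.scomp β (hasDerivAt_exp_smul_const Φ.hamiltonian (-β))
      (hasDerivAt_neg β)).differentiableAt
  exact (Matrix.traceLinearMap (Config Λ d) ℂ ℂ).toContinuousLinearMap.differentiable.comp h1

end QuditLattice.Interaction

/-! ### Zero-freeness, logarithm and two-sided bound -/

theorem mainTheorem2 {D : ℕ} (Λ : Finset (Fin D → ℤ)) (d : ℕ) (hd : 1 ≤ d)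
    (Φ : QuditLattice.Interaction Λ d) (κ : ℕ) (R h g : ℝ)
    (hκ : 1 ≤ κ) (hh : 0 < h) (hg : 0 < g)
    (hlocal : Φ.IsGeometricallyLocal κ R)
    (hnorm : Φ.TermNormLE h)
    (hgrowth : Φ.IsGrowthConstant h g) :
    (∀ β : ℂ, ‖β‖ ≤ 1 / (5 * Real.exp 1 * g * h * κ) → Φ.partitionFunction β ≠ 0) ∧
    (∃ L : ℂ → ℂ,
      AnalyticOnNhd ℂ L (Metric.closedBall 0 (1 / (5 * Real.exp 1 * g * h * κ))) ∧
      L 0 = (Real.log (d : ℝ) : ℂ) * (Λ.card : ℂ) ∧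
      ∀ β ∈ Metric.closedBall (0 : ℂ) (1 / (5 * Real.exp 1 * g * h * κ)),
        Complex.exp (L β) = Φ.partitionFunction β) ∧
    (∀ β : ℂ, ‖β‖ ≤ 1 / (5 * Real.exp 1 * g * h * κ) →
      |Real.log ‖Φ.partitionFunction β‖| ≤
        (Real.exp 1 ^ 2 * g * h * ‖β‖ + Real.log d) * Λ.card) := by
  have hgh : 0 ≤ g * h := (mul_pos hg hh).le
  have hκ0 : (0 : ℝ) < κ := by exact_mod_cast hκ
  have hd0 : (0 : ℝ) < d := by exact_mod_cast hd
  have hcard : Fintype.card (QuditLattice.Config Λ d) = d ^ Λ.card := by simp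
  have hlower : ∀ β : ℂ, ‖β‖ ≤ 1 / (5 * Real.exp 1 * g * h * κ) →
      1 ≤ Real.exp (Real.exp 1 ^ 2 * (g * h * ‖β‖)) ^ Λ.card *
        ‖Φ.normalizedTrace β Finset.univ‖ := by
    intro β hβ
    rw [le_div_iff₀ (by positivity)] at hβ
    refine QuditLattice.Interaction.one_le_norm_normalizedTrace hd hκ hlocal hgrowth hgh ?_
    linarith
  have hpos : ∀ β : ℂ, ‖β‖ ≤ 1 / (5 * Real.exp 1 * g * h * κ) →
      0 < ‖Φ.normalizedTrace β Finset.univ‖ := fun β hβ =>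
    pos_of_mul_pos_right (zero_lt_one.trans_le (hlower β hβ)) (by positivity)
  have hne : ∀ β : ℂ, ‖β‖ ≤ 1 / (5 * Real.exp 1 * g * h * κ) →
      Φ.partitionFunction β ≠ 0 := by
    intro β hβ
    rw [Φ.partitionFunction_eq hd]
    exact mul_ne_zero (QuditLattice.Interaction.card_config_ne_zero hd)
      (norm_pos_iff.1 (hpos β hβ))
  refine ⟨hne, ?_, fun β hβ => ?_⟩
  · refine exists_log_on_closedBall (by positivity) Φ.differentiable_partitionFunction
      (fun z hz => hne z (by simpa using hz)) ?_
    have hZ : Φ.partitionFunction 0 = ((d ^ Λ.card : ℕ) : ℂ) := by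
      rw [← hcard, QuditLattice.Interaction.partitionFunction, neg_zero, zero_smul,
        NormedSpace.exp_zero, Matrix.trace_one]
    rw [hZ, mul_comm, Complex.exp_nat_mul, ← Complex.ofReal_exp, Real.exp_log hd0]
    push_cast
    rfl
  · have hp := hpos β hβ
    have hlog : Real.log ‖Φ.partitionFunction β‖ =
        Λ.card * Real.log d + Real.log ‖Φ.normalizedTrace β Finset.univ‖ := by
      rw [Φ.partitionFunction_eq hd, norm_mul, RCLike.norm_natCast, hcard, Nat.cast_pow,
        Real.log_mul (by positivity) hp.ne', Real.log_pow]
    have hlog0 : 0 ≤ Λ.card * Real.log d :=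
      mul_nonneg (Nat.cast_nonneg _) (Real.log_nonneg (by exact_mod_cast hd))
    have h1 : 0 ≤ Λ.card * (Real.exp 1 ^ 2 * (g * h * ‖β‖)) +
        Real.log ‖Φ.normalizedTrace β Finset.univ‖ := by
      have := Real.log_nonneg (hlower β hβ)
      rwa [Real.log_mul (by positivity) hp.ne', Real.log_pow, Real.log_exp] at this
    have h2 : Real.log ‖Φ.normalizedTrace β Finset.univ‖ ≤ g * h * ‖β‖ * Λ.card := by
      refine (Real.log_le_log hp (Φ.norm_normalizedTrace_le hd β)).trans ?_
      rw [Real.log_exp]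
      calc _ ≤ ‖β‖ * (g * h * Λ.card) := mul_le_mul_of_nonneg_left
            (QuditLattice.Interaction.sum_opNorm_le hgrowth) (norm_nonneg _)
        _ = _ := by ring
    have h3 : g * h * ‖β‖ * Λ.card ≤ Λ.card * (Real.exp 1 ^ 2 * (g * h * ‖β‖)) := by
      have h4 : 0 ≤ g * h * ‖β‖ * Λ.card := by positivity
      have h5 : (1 : ℝ) ≤ Real.exp 1 ^ 2 := one_le_pow₀ (Real.one_le_exp zero_le_one)
      nlinarith
    rw [hlog, abs_le]
    constructor <;> linarith
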